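/- All graphs are finite and simple. A graph is $F$-free if it has no (not necessarily induced) subgraph isomorphic to $F$. For graphs $H$ and $F$, where $F$ has at least one edge, and an integer $n$, let $\mathrm{Ex}(n,H,F)$ be the maximum possible number of copies of $H$ (that is, of subgraphs isomorphic to $H$) in an $F$-free graph on $n$ vertices. **Theorem.** Let $T$ be a tree with at least two vertices and let $H$ be a $T$-free graph. Then there is an integer $r = r(H,T) \ge 0$, depending only on $H$ and $T$, such that $\mathrm{Ex}(n,H,T) = \Theta(n^r)$ as $n \to \infty$; that is, there are constants $c, C > 0$ and $n_0$, depending only on $H$ and $T$, such that $c\, n^r \le \mathrm{Ex}(n,H,T) \le C\, n^r$ for all $n \ge n_0$. -/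

import Mathlib

open scoped Classical in
/-- `Ex n H F`, the generalized Turán number: the maximum number of copies of `H` (that is, of
subgraphs isomorphic to `H`) in an `F`-free graph on `n` vertices. The maximum is over a finite
set of graphs, which is nonempty as soon as `F` has an edge (it contains the empty graph). -/
noncomputable def Ex {V W : Type*} (n : ℕ) (H : SimpleGraph V) (F : SimpleGraph W) : ℕ :=
  Finset.sup {G : SimpleGraph (Fin n) | F.Free G} fun G => G.copyCount H

/-! The exponent is the largest number of components of `H[U]` over the sets `U` for which the
blow-up of `H` along `U` is `T`-free. Lower bound: in such a blow-up cut to finitely many layers,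
each component of `H[U]` chooses its layer independently (`pow_le_Ex`). Upper bound: averaging over
colourings of `G` by the vertices of `H` costs a constant factor. So does passing to a family of
copies in which, for all `x`, `y`, the image of `x` either determines that of `y` or leaves at least
`|T|` choices for it (`card_le_cleaningConstant_mul`). With this much room, trees embed greedily
(`isContained_of_branching`). Hence an edge branching both ways would put `T` into `G`, and so would
a copy of `T` in the blow-up along the set `U` of vertices maximal for determination. So one end of
each edge determines the other, a component of `H[U]` is fixed by the image of any one of its
vertices, and `U` determines everything: there are at most `n ^ c` copies in the family, where `c`
is the number of components of `H[U]`. -/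

/-! ### Determination and branching in families of maps -/

/-- In the family `F`, the value at `x` determines the value at `y`. -/
def Determines {V X : Type*} (F : Finset (V → X)) (x y : V) : Prop :=
  ∀ φ ∈ F, ∀ ψ ∈ F, φ x = ψ x → φ y = ψ y

open scoped Classical in
/-- The values at `y` of the members of `F` that send `x` to `a`. -/
noncomputable def valuesOver {V X : Type*} (F : Finset (V → X)) (x y : V) (a : X) : Finset X :=
  (F.filter fun ψ => ψ x = a).image fun ψ => ψ y

/-- In the family `F`, every value taken at `x` is compatible with at least `t` values at `y`. -/
def Branches {V X : Type*} (F : Finset (V → X)) (t : ℕ) (x y : V) : Prop :=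
  ∀ φ ∈ F, t ≤ (valuesOver F x y (φ x)).card

theorem mem_valuesOver {V X : Type*} {F : Finset (V → X)} {x y : V} {a b : X} :
    b ∈ valuesOver F x y a ↔ ∃ ψ ∈ F, ψ x = a ∧ ψ y = b := by
  simp [valuesOver, and_assoc]

theorem Determines.refl {V X : Type*} (F : Finset (V → X)) (x : V) : Determines F x x :=
  fun _ _ _ _ h => h

theorem Determines.trans {V X : Type*} {F : Finset (V → X)} {x y z : V}
    (h₁ : Determines F x y) (h₂ : Determines F y z) : Determines F x z :=
  fun φ hφ ψ hψ h => h₂ φ hφ ψ hψ (h₁ φ hφ ψ hψ h)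

theorem Determines.mono {V X : Type*} {F F' : Finset (V → X)} {x y : V}
    (h : Determines F x y) (hF : F' ⊆ F) : Determines F' x y :=
  fun φ hφ ψ hψ => h φ (hF hφ) ψ (hF hψ)

/-! ### Cleaning a family -/

open scoped Classical in
/-- If each value at `x` allows at most `t` values at `y`, then `F` splits into `t` subfamilies in
which `x` determines `y`. -/
theorem card_le_of_valuesOver_le {V X : Type*} {F : Finset (V → X)} {t N : ℕ} {x y : V}
    (ht : ∀ φ ∈ F, (valuesOver F x y (φ x)).card ≤ t)
    (hN : ∀ F' ⊆ F, Determines F' x y → F'.card ≤ N) : F.card ≤ N * t := by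
  have key : ∀ I : Finset X, ∃ e : X → ℕ, Set.InjOn e I ∧ ∀ b ∈ I, e b < I.card := by
    intro I
    refine ⟨fun b => if h : b ∈ I then (I.equivFin ⟨b, h⟩ : ℕ) else 0, ?_, ?_⟩
    · intro b hb c hc h
      have hb' : b ∈ I := hb
      have hc' : c ∈ I := hc
      simp only [hb', hc', dite_true] at h
      simpa using I.equivFin.injective (Fin.ext h)
    · intro b hb
      simp only [hb, dite_true]
      exact (I.equivFin ⟨b, hb⟩).2
  choose e he hlt using fun a => key (valuesOver F x y a)
  have hmem : ∀ φ ∈ F, φ y ∈ valuesOver F x y (φ x) :=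
    fun φ hφ => mem_valuesOver.2 ⟨φ, hφ, rfl, rfl⟩
  -- Classify `φ` by the index of `φ y` among the values allowed over `φ x`; within a class, `x`
  -- determines `y`.
  have := Finset.card_le_mul_card_image_of_maps_to (s := F) (t := Finset.range t)
    (f := fun φ => e (φ x) (φ y))
    (fun φ hφ => Finset.mem_range.2 ((hlt _ _ (hmem φ hφ)).trans_le (ht φ hφ))) N ?_
  · simpa using this
  · intro j _
    refine hN _ (Finset.filter_subset _ _) ?_
    intro φ hφ ψ hψ h
    rw [Finset.mem_filter] at hφ hψ
    refine he (φ x) (hmem φ hφ.1) ?_ ?_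
    · rw [h]; exact hmem ψ hψ.1
    · rw [hφ.2, h, hψ.2]

open scoped Classical in
/-- Any finite family decomposes into a subfamily in which all pairs of `P` branch, and one
subfamily for each pair of `P` in which this pair has few values. -/
theorem exists_branching_decomposition {V X : Type*} (t : ℕ) (P : Finset (V × V))
    (F : Finset (V → X)) :
    ∃ (F' : Finset (V → X)) (R : V × V → Finset (V → X)), F' ⊆ F ∧ (∀ p, R p ⊆ F) ∧
      F ⊆ F' ∪ P.biUnion R ∧ (∀ p ∈ P, Branches F' t p.1 p.2) ∧
      ∀ p, ∀ φ ∈ R p, (valuesOver (R p) p.1 p.2 (φ p.1)).card ≤ t := by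
  induction F using Finset.strongInduction with
  | H F ih =>
    by_cases hF : ∀ p ∈ P, Branches F t p.1 p.2
    · exact ⟨F, fun _ => ∅, subset_rfl, by simp, by simp, hF, by simp⟩
    simp only [Branches, not_forall, not_le] at hF
    obtain ⟨p, hp, φ, hφ, hlt⟩ := hF
    -- The whole fibre over the bad value is removed, so the fibres collected in `R p` have distinct
    -- values at `p.1` and their counts do not mix.
    set A := F.filter fun ψ => ψ p.1 = φ p.1 with hA
    have hφA : φ ∈ A := by simp [hA, hφ]
    obtain ⟨F', R, hF', hR, hcov, hbr, hfew⟩ := ih (F \ A)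
      (Finset.sdiff_ssubset (Finset.filter_subset _ _) ⟨φ, hφA⟩)
    refine ⟨F', Function.update R p (R p ∪ A), hF'.trans Finset.sdiff_subset, ?_, ?_, hbr, ?_⟩
    · intro q
      by_cases hq : q = p
      · subst hq
        simpa using Finset.union_subset ((hR q).trans Finset.sdiff_subset)
          (Finset.filter_subset _ _)
      · simpa [hq] using (hR q).trans Finset.sdiff_subset
    · intro ψ hψ
      by_cases hψA : ψ ∈ A
      · exact Finset.mem_union_right _ (Finset.mem_biUnion.2 ⟨p, hp, by simp [hψA]⟩)
      · rcases Finset.mem_union.1 (hcov (Finset.mem_sdiff.2 ⟨hψ, hψA⟩)) with h | h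
        · exact Finset.mem_union_left _ h
        · obtain ⟨q, hq, hψq⟩ := Finset.mem_biUnion.1 h
          refine Finset.mem_union_right _ (Finset.mem_biUnion.2 ⟨q, hq, ?_⟩)
          by_cases hqp : q = p
          · subst hqp; simp [hψq]
          · simpa [hqp] using hψq
    · intro q ψ hψ
      by_cases hqp : q = p
      · subst hqp
        simp only [Function.update_self] at hψ ⊢
        have hsep : ∀ χ ∈ R q, χ q.1 ≠ φ q.1 := by
          intro χ hχ h
          have := Finset.mem_sdiff.1 (hR q hχ)
          exact this.2 (Finset.mem_filter.2 ⟨this.1, h⟩)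
        by_cases hψφ : ψ q.1 = φ q.1
        · refine le_trans (Finset.card_le_card ?_) hlt.le
          intro b hb
          obtain ⟨χ, hχ, h1, h2⟩ := mem_valuesOver.1 hb
          have hχF : χ ∈ F := by
            rcases Finset.mem_union.1 hχ with h | h
            · exact Finset.sdiff_subset (hR q h)
            · exact Finset.filter_subset _ _ h
          exact mem_valuesOver.2 ⟨χ, hχF, h1.trans hψφ, h2⟩
        · have hψR : ψ ∈ R q := by
            rcases Finset.mem_union.1 hψ with h | h
            · exact h
            · exact absurd (Finset.mem_filter.1 h).2 hψφ
          refine le_trans (Finset.card_le_card ?_) (hfew q ψ hψR)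
          intro b hb
          obtain ⟨χ, hχ, h1, h2⟩ := mem_valuesOver.1 hb
          rcases Finset.mem_union.1 hχ with h | h
          · exact mem_valuesOver.2 ⟨χ, h, h1, h2⟩
          · exact absurd (h1.symm.trans (Finset.mem_filter.1 h).2) hψφ
      · simp only [Function.update_of_ne hqp] at hψ ⊢
        exact hfew q ψ hψ

/-- The constant lost in passing to a family in which each of `m` pairs determines or branches. -/
def cleaningConstant (t : ℕ) : ℕ → ℕ
  | 0 => 1
  | m + 1 => 1 + (m + 1) * (cleaningConstant t m * t)

open scoped Classical in
/-- A bound for all subfamilies in which every pair determines or branches yields a bound for the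
whole family. -/
theorem card_le_cleaningConstant_mul {V X : Type*} {t B : ℕ} {F₀ : Finset (V → X)}
    (hB : ∀ F ⊆ F₀, (∀ x y, Determines F x y ∨ Branches F t x y) → F.card ≤ B) (m : ℕ) :
    ∀ P : Finset (V × V), P.card = m → ∀ F ⊆ F₀, (∀ p ∉ P, Determines F p.1 p.2) →
      F.card ≤ cleaningConstant t m * B := by
  induction m with
  | zero =>
    intro P hP F hF hdet
    rw [Finset.card_eq_zero] at hP
    subst hP
    simpa [cleaningConstant] using hB F hF fun x y => Or.inl (hdet (x, y) (by simp))
  | succ m ih =>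
    intro P hP F hF hdet
    -- Determination passes to subfamilies but branching does not, so `F'` must branch on all of `P`
    -- at once. Each `R p` splits into `t` families in which `p` leaves `P` for good.
    obtain ⟨F', R, hF', hR, hcov, hbr, hfew⟩ := exists_branching_decomposition t P F
    have h1 : F'.card ≤ B := by
      refine hB F' (hF'.trans hF) fun x y => ?_
      by_cases hp : (x, y) ∈ P
      · exact Or.inr (hbr _ hp)
      · exact Or.inl ((hdet _ hp).mono hF')
    have h2 : ∀ p ∈ P, (R p).card ≤ cleaningConstant t m * B * t := by
      intro p hp
      refine card_le_of_valuesOver_le (hfew p) fun G hG hGdet => ?_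
      refine ih (P.erase p) (by rw [Finset.card_erase_of_mem hp, hP]; rfl) G
        ((hG.trans (hR p)).trans hF) fun q hq => ?_
      by_cases hqp : q = p
      · subst hqp; exact hGdet
      · exact (hdet q fun h => hq (Finset.mem_erase.2 ⟨hqp, h⟩)).mono (hG.trans (hR p))
    calc F.card ≤ (F' ∪ P.biUnion R).card := Finset.card_le_card hcov
      _ ≤ F'.card + (P.biUnion R).card := Finset.card_union_le _ _
      _ ≤ B + P.card * (cleaningConstant t m * B * t) :=
        add_le_add h1 (Finset.card_biUnion_le_card_mul _ _ _ h2)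
      _ = cleaningConstant t (m + 1) * B := by rw [hP, cleaningConstant]; ring

/-! ### Greedy embedding of trees -/

open scoped Classical in
/-- A finite tree can be grown from any vertex by repeatedly attaching leaves. -/
theorem SimpleGraph.IsTree.grow_induction {W : Type*} [Fintype W] {T : SimpleGraph W}
    (hT : T.IsTree) (ρ : W) {P : Finset W → Prop} (root : P {ρ})
    (step : ∀ (S : Finset W) (w w' : W), w ∈ S → w' ∉ S → T.Adj w w' →
      (∀ z ∈ S, T.Adj z w' → z = w) → P S → P (insert w' S)) : P Finset.univ := by
  let Q : Finset W → Prop := fun S =>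
    P S ∧ ρ ∈ S ∧ ∀ s ∈ S, ∃ p : T.Walk ρ s, p.IsPath ∧ ∀ z ∈ p.support, z ∈ S
  have hQ : Q {ρ} := ⟨root, by simp, fun s hs => by
    rw [Finset.mem_singleton] at hs
    subst hs
    exact ⟨.nil, .nil, by simp⟩⟩
  obtain ⟨S, ⟨hPS, hρ, hpath⟩, hmax⟩ :=
    (Set.toFinite {S | Q S}).exists_maximalFor Finset.card _ ⟨_, hQ⟩
  by_cases hS : S = Finset.univ
  · exact hS ▸ hPS
  exfalso
  obtain ⟨v, hv⟩ : ∃ v, v ∉ S := by simpa [Finset.eq_univ_iff_forall] using hS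
  obtain ⟨p⟩ := hT.connected.preconnected ρ v
  obtain ⟨d, -, hd1, hd2⟩ := p.exists_boundary_dart (S : Set W) hρ hv
  have hpath' : ∀ z ∈ S, T.Adj z d.snd → ∃ q : T.Walk ρ d.snd, q.IsPath ∧ q.penultimate = z ∧
      ∀ y ∈ q.support, y ∈ insert d.snd S := by
    intro z hz hadj
    obtain ⟨q, hq, hqS⟩ := hpath z hz
    refine ⟨q.concat hadj, hq.concat (fun h => hd2 (hqS _ h)) hadj, by simp, ?_⟩
    intro y hy
    rw [SimpleGraph.Walk.support_concat] at hy
    simp only [List.mem_append, List.mem_singleton] at hy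
    rcases hy with h | h
    · exact Finset.mem_insert_of_mem (hqS _ h)
    · simp [h]
  have hnew : Q (insert d.snd S) := by
    obtain ⟨q, hq, hqz, hqS⟩ := hpath' _ hd1 d.adj
    refine ⟨step S d.fst d.snd hd1 hd2 d.adj ?_ hPS, Finset.mem_insert_of_mem hρ, ?_⟩
    -- A second neighbour in `S` would give a second path from `ρ` to the new vertex.
    · intro z hz hadj
      obtain ⟨q', hq', hqz', -⟩ := hpath' z hz hadj
      have := congrArg Subtype.val ((hT.isAcyclic.subsingleton_path _ _).elim ⟨q, hq⟩ ⟨q', hq'⟩)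
      simp only at this
      rw [← hqz, ← hqz', this]
    · intro s hs
      rcases Finset.mem_insert.1 hs with rfl | hs
      · exact ⟨q, hq, hqS⟩
      · obtain ⟨q, hq, hqS⟩ := hpath s hs
        exact ⟨q, hq, fun z hz => Finset.mem_insert_of_mem (hqS z hz)⟩
  have := hmax hnew (Finset.card_le_card (Finset.subset_insert _ _))
  rw [Finset.card_insert_of_notMem hd2] at this
  omega

open scoped Classical in
/-- Greedy embedding of a tree `T` along a map `f` from `T` to `H`, using members of a family of
colour-respecting maps from `H` to `G`. -/
theorem isContained_of_branching {V W X : Type*} [Fintype W] {H : SimpleGraph V}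
    {T : SimpleGraph W} {G : SimpleGraph X} (hT : T.IsTree) {F : Finset (V → X)}
    (hFne : F.Nonempty) (χ : X → Option V) (hχ : ∀ φ ∈ F, ∀ v, χ (φ v) = some v)
    (hom : ∀ φ ∈ F, ∀ u v, H.Adj u v → G.Adj (φ u) (φ v)) (U : Set V) (f : W → V) (i : W → ℕ)
    (hinj : ∀ w w', f w = f w' → i w = i w' → w = w') (hi : ∀ w, f w ∉ U → i w = 0)
    (hadj : ∀ w w', T.Adj w w' → H.Adj (f w) (f w'))
    (hstep : ∀ w w', T.Adj w w' → Branches F (Fintype.card W) (f w) (f w') ∨ f w' ∉ U ∨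
      (f w ∈ U ∧ Determines F (f w) (f w') ∧ Determines F (f w') (f w) ∧ i w = i w')) :
    T.IsContained G := by
  obtain ⟨φ₀, hφ₀⟩ := hFne
  obtain ⟨ρ⟩ := hT.connected.nonempty
  -- Each `w` carries its own member `Φ w` and is placed at `Φ w (f w)`. The last clause implies
  -- injectivity; it compares mutually determining vertices, not only equal ones, so that it
  -- survives steps that reuse `Φ w`.
  let P : Finset W → Prop := fun S => ∃ Φ : W → V → X, (∀ w ∈ S, Φ w ∈ F) ∧
    (∀ w ∈ S, ∀ w' ∈ S, T.Adj w w' → G.Adj (Φ w (f w)) (Φ w' (f w'))) ∧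
    ∀ w ∈ S, ∀ w' ∈ S, f w ∈ U → f w' ∈ U → Determines F (f w) (f w') →
      Determines F (f w') (f w) → Φ w (f w) = Φ w' (f w) → i w = i w'
  have hP : P Finset.univ := by
    refine hT.grow_induction ρ ?_ ?_
    · refine ⟨fun _ => φ₀, fun _ _ => hφ₀, ?_, ?_⟩
      · intro w hw w' hw' h
        rw [Finset.mem_singleton] at hw hw'
        subst hw hw'
        exact absurd h (T.irrefl)
      · intro w hw w' hw'
        rw [Finset.mem_singleton] at hw hw'
        subst hw hw'
        simp
    · rintro S w w' hw hw' hww' huniq ⟨Φ, hΦF, hΦadj, hΦi⟩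
      have hne : ∀ z ∈ S, z ≠ w' := fun z hz h => hw' (h ▸ hz)
      suffices h : ∃ ψ ∈ F, ψ (f w) = Φ w (f w) ∧ ∀ z ∈ S, f z ∈ U → f w' ∈ U →
          Determines F (f z) (f w') → Determines F (f w') (f z) →
          ψ (f w') = Φ z (f w') → i z = i w' by
        obtain ⟨ψ, hψF, hψw, hψi⟩ := h
        have hψadj : G.Adj (Φ w (f w)) (ψ (f w')) := hψw ▸ hom ψ hψF _ _ (hadj _ _ hww')
        have hold : ∀ z ∈ S, Function.update Φ w' ψ z = Φ z :=
          fun z hz => Function.update_of_ne (hne z hz) _ _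
        refine ⟨Function.update Φ w' ψ, ?_, ?_, ?_⟩
        · intro z hz
          rcases Finset.mem_insert.1 hz with rfl | hz
          · simpa using hψF
          · rw [hold z hz]; exact hΦF z hz
        · intro y hy z hz hyz
          rcases Finset.mem_insert.1 hy with rfl | hyS <;>
            rcases Finset.mem_insert.1 hz with rfl | hzS
          · exact absurd hyz T.irrefl
          · obtain rfl := huniq z hzS hyz.symm
            rw [hold z hzS, Function.update_self]
            exact hψadj.symm
          · obtain rfl := huniq y hyS hyz
            rw [hold y hyS, Function.update_self]
            exact hψadj
          · rw [hold y hyS, hold z hzS]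
            exact hΦadj y hyS z hzS hyz
        · intro y hy z hz
          rcases Finset.mem_insert.1 hy with rfl | hyS <;>
            rcases Finset.mem_insert.1 hz with rfl | hzS
          · intros; rfl
          · rw [hold z hzS, Function.update_self]
            intro h1 h2 h3 h4 h5
            exact (hψi z hzS h2 h1 h4 h3 h5).symm
          · rw [hold y hyS, Function.update_self]
            intro h1 h2 h3 h4 h5
            exact hψi y hyS h1 h2 h3 h4 (h3 _ (hΦF y hyS) _ hψF h5).symm
          · rw [hold y hyS, hold z hzS]
            exact hΦi y hyS z hzS
      -- When branching, fewer than `|W|` values are in use at `f w'`, so a fresh one exists.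
      -- Otherwise `Φ w` is reused: the label condition is void outside `U`, and inherited from `w`
      -- in the last case.
      rcases hstep w w' hww' with hbr | hU | ⟨hU, hd1, hd2, hii⟩
      · have hcard : (S.image fun z => Φ z (f w')).card <
            (valuesOver F (f w) (f w') (Φ w (f w))).card := by
          refine (Finset.card_image_le.trans_lt ?_).trans_le (hbr _ (hΦF w hw))
          exact Finset.card_lt_univ_of_notMem hw'
        obtain ⟨b, hb, hbS⟩ := Finset.exists_mem_notMem_of_card_lt_card hcard
        obtain ⟨ψ, hψF, hψw, rfl⟩ := mem_valuesOver.1 hb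
        refine ⟨ψ, hψF, hψw, fun z hz _ _ _ _ h => ?_⟩
        exact absurd (Finset.mem_image.2 ⟨z, hz, h.symm⟩) hbS
      · exact ⟨Φ w, hΦF w hw, rfl, fun z _ _ h => absurd h hU⟩
      · refine ⟨Φ w, hΦF w hw, rfl, fun z hz h1 h2 h3 h4 h5 => ?_⟩
        rw [← hii]
        exact (hΦi w hw z hz hU h1 (hd1.trans h4) (h3.trans hd2)
          (hd2 _ (hΦF w hw) _ (hΦF z hz) h5)).symm
  obtain ⟨Φ, hΦF, hΦadj, hΦi⟩ := hP
  refine ⟨⟨⟨fun w => Φ w (f w), fun {a b} h => hΦadj a (by simp) b (by simp) h⟩, ?_⟩⟩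
  intro w w' h
  change Φ w (f w) = Φ w' (f w') at h
  have hf : f w = f w' := by
    have h' := congrArg χ h
    rw [hχ _ (hΦF w (by simp)), hχ _ (hΦF w' (by simp))] at h'
    exact Option.some.inj h'
  refine hinj w w' hf ?_
  by_cases hU : f w ∈ U
  · refine hΦi w (by simp) w' (by simp) hU (hf ▸ hU) ?_ ?_ ?_
    · rw [hf]; exact .refl _ _
    · rw [hf]; exact .refl _ _
    · rw [h, hf]
  · rw [hi w hU, hi _ (hf ▸ hU)]

/-! ### Blow-ups and maximal vertices -/

/-- The blow-up of `H` along `U`: infinitely many copies of `H[U]`, labelled by the positive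
integers, glued along the vertices outside `U`, which carry the label `0`. The pairs `(v, i)` for
which the label does not fit are isolated vertices. -/
def blowUp {V : Type*} (H : SimpleGraph V) (U : Set V) : SimpleGraph (V × ℕ) where
  Adj a b := H.Adj a.1 b.1 ∧ (a.2 = 0 ↔ a.1 ∉ U) ∧ (b.2 = 0 ↔ b.1 ∉ U) ∧
    (a.1 ∈ U → b.1 ∈ U → a.2 = b.2)
  symm.symm _ _ h := ⟨h.1.symm, h.2.2.1, h.2.1, fun ha hb => (h.2.2.2 hb ha).symm⟩
  loopless := ⟨fun _ h => H.irrefl h.1⟩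

/-- If each pair of vertices determines or branches in a family of colour-respecting copies of `H`
in a `T`-free graph, then along each edge of `H` one end determines the other. -/
theorem determines_or_determines_of_adj {V W X : Type*} [Fintype W] {H : SimpleGraph V}
    {T : SimpleGraph W} {G : SimpleGraph X} (hT : T.IsTree) (hG : T.Free G) {F : Finset (V → X)}
    (hFne : F.Nonempty) (χ : X → Option V) (hχ : ∀ φ ∈ F, ∀ v, χ (φ v) = some v)
    (hom : ∀ φ ∈ F, ∀ u v, H.Adj u v → G.Adj (φ u) (φ v))
    (hF : ∀ x y, Determines F x y ∨ Branches F (Fintype.card W) x y) {x y : V}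
    (hxy : H.Adj x y) : Determines F x y ∨ Determines F y x := by
  by_contra! hcon
  have hb1 := (hF x y).resolve_left hcon.1
  have hb2 := (hF y x).resolve_left hcon.2
  let κ := hT.coloringTwo
  have hκ : ∀ w w', T.Adj w w' → (κ w = 0 ∧ κ w' = 1) ∨ (κ w = 1 ∧ κ w' = 0) := by
    intro w w' h
    have := κ.valid h
    omega
  -- The 2-colouring folds `T` onto the edge `xy`; every step then branches, and distinct labels
  -- separate the vertices of `T`.
  let f : W → V := fun w => if κ w = 0 then x else y
  refine hG (isContained_of_branching (H := H) hT hFne χ hχ hom Set.univ f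
    (fun w => Fintype.equivFin W w) ?_ ?_ ?_ ?_)
  · intro w w' _ h
    exact (Fintype.equivFin W).injective (Fin.ext h)
  · simp
  · intro w w' h
    rcases hκ w w' h with ⟨h0, h1⟩ | ⟨h0, h1⟩
    · simpa [f, h0, h1] using hxy
    · simpa [f, h0, h1] using hxy.symm
  · intro w w' h
    rcases hκ w w' h with ⟨h0, h1⟩ | ⟨h0, h1⟩
    · exact Or.inl (by simpa [f, h0, h1] using hb1)
    · exact Or.inl (by simpa [f, h0, h1] using hb2)

/-- The vertices that are maximal in the preorder of determination. -/
def maximalVertices {V X : Type*} (F : Finset (V → X)) : Set V :=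
  {y | ∀ z, Determines F z y → Determines F y z}

/-- Among the vertices determining `y`, take one that determines an inclusion-maximal set of
vertices. -/
theorem exists_mem_maximalVertices {V X : Type*} [Finite V] (F : Finset (V → X)) (y : V) :
    ∃ z ∈ maximalVertices F, Determines F z y := by
  obtain ⟨z, hz, hmax⟩ := (Set.toFinite {z | Determines F z y}).exists_maximalFor
    (fun z => {v | Determines F z v}) _ ⟨y, Determines.refl F y⟩
  refine ⟨z, fun v hv => ?_, hz⟩
  have : {u | Determines F v u} ≤ {u | Determines F z u} :=
    hmax (j := v) (hv.trans hz) fun u hu => hv.trans hu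
  exact this (Determines.refl F v)

/-- If `x` determines a maximal `y`, then `x` is maximal and `y` determines `x`; for an edge of the
blow-up, the two labels then agree. So every edge of a copy of `T` falls under a case of the greedy
embedding. -/
theorem free_blowUp_maximalVertices {V W X : Type*} [Fintype W] {H : SimpleGraph V}
    {T : SimpleGraph W} [Nontrivial W] {G : SimpleGraph X} (hT : T.IsTree) (hG : T.Free G)
    {F : Finset (V → X)}
    (hFne : F.Nonempty) (χ : X → Option V) (hχ : ∀ φ ∈ F, ∀ v, χ (φ v) = some v)
    (hom : ∀ φ ∈ F, ∀ u v, H.Adj u v → G.Adj (φ u) (φ v))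
    (hF : ∀ x y, Determines F x y ∨ Branches F (Fintype.card W) x y) :
    T.Free (blowUp H (maximalVertices F)) := by
  rintro ⟨g⟩
  have hg : ∀ {w w'}, T.Adj w w' → (blowUp H (maximalVertices F)).Adj (g w) (g w') :=
    fun h => g.toHom.map_adj h
  refine hG (isContained_of_branching (H := H) hT hFne χ hχ hom (maximalVertices F)
    (fun w => (g w).1) (fun w => (g w).2) ?_ ?_ ?_ ?_)
  · intro w w' h1 h2
    exact g.injective (Prod.ext h1 h2)
  · intro w hw
    obtain ⟨w', h⟩ := hT.connected.preconnected.exists_adj_of_nontrivial w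
    exact (hg h).2.1.2 hw
  · intro w w' h
    exact (hg h).1
  · intro w w' h
    by_cases hy : (g w').1 ∈ maximalVertices F
    · rcases hF (g w).1 (g w').1 with hd | hb
      · have hx : (g w).1 ∈ maximalVertices F := fun z hz => hd.trans (hy z (hz.trans hd))
        exact Or.inr (Or.inr ⟨hx, hd, hy _ hd, (hg h).2.2.2 hx hy⟩)
      · exact Or.inl hb
    · exact Or.inr (Or.inl hy)

/-- A family in which every pair determines or branches has at most `|X| ^ c` members, where `c` is
the number of components of `H` induced on the maximal vertices. -/
theorem card_le_pow_card_connectedComponent {V X : Type*} [Finite V] [Fintype X]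
    {H : SimpleGraph V} {F : Finset (V → X)}
    (hedge : ∀ x y, H.Adj x y → Determines F x y ∨ Determines F y x) :
    F.card ≤ Fintype.card X ^
      Nat.card (H.induce (maximalVertices F)).ConnectedComponent := by
  classical
  have := Fintype.ofFinite (H.induce (maximalVertices F)).ConnectedComponent
  have hdet : ∀ a b, (H.induce (maximalVertices F)).Reachable a b → Determines F a b := by
    rintro a b ⟨p⟩
    induction p with
    | nil => exact .refl _ _
    | @cons u v w h p ih =>
      refine Determines.trans ?_ ih
      rcases hedge u v h with h' | h'
      · exact h'
      · exact u.2 _ h'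
  rw [Nat.card_eq_fintype_card, ← Fintype.card_fun, ← Finset.card_univ]
  -- A member is recovered from its values at one representative per component.
  refine Finset.card_le_card_of_injOn
    (fun φ (c : (H.induce (maximalVertices F)).ConnectedComponent) => φ c.out) (by simp) ?_
  intro φ hφ ψ hψ h
  funext y
  obtain ⟨z, hz, hzy⟩ := exists_mem_maximalVertices F y
  let c := (H.induce (maximalVertices F)).connectedComponentMk ⟨z, hz⟩
  have hc : (H.induce (maximalVertices F)).Reachable c.out ⟨z, hz⟩ :=
    SimpleGraph.ConnectedComponent.exact (Quot.out_eq c)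
  exact ((hdet _ _ hc).trans hzy) φ hφ ψ hψ (congrFun h c)

/-! ### Upper bound: from coloured copies to all copies -/

theorem card_colourRespecting_le {V W X : Type*} [Fintype V] [Fintype W] [Fintype X] [Nonempty X]
    [Nontrivial W] {H : SimpleGraph V} {T : SimpleGraph W} {G : SimpleGraph X} (hT : T.IsTree)
    (hG : T.Free G) {r : ℕ}
    (hr : ∀ U : Set V, T.Free (blowUp H U) → Nat.card (H.induce U).ConnectedComponent ≤ r)
    {F : Finset (V → X)} (χ : X → Option V) (hχ : ∀ φ ∈ F, ∀ v, χ (φ v) = some v)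
    (hom : ∀ φ ∈ F, ∀ u v, H.Adj u v → G.Adj (φ u) (φ v)) :
    F.card ≤ cleaningConstant (Fintype.card W) (Fintype.card (V × V)) * Fintype.card X ^ r := by
  classical
  refine card_le_cleaningConstant_mul (F₀ := F) ?_ _ Finset.univ Finset.card_univ F subset_rfl
    (by simp)
  intro F' hF' hhom
  rcases F'.eq_empty_or_nonempty with rfl | hne
  · simp
  have hχ' : ∀ φ ∈ F', ∀ v, χ (φ v) = some v := fun φ hφ => hχ φ (hF' hφ)
  have hom' : ∀ φ ∈ F', ∀ u v, H.Adj u v → G.Adj (φ u) (φ v) := fun φ hφ => hom φ (hF' hφ)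
  refine (card_le_pow_card_connectedComponent fun x y hxy =>
    determines_or_determines_of_adj hT hG hne χ hχ' hom' hhom hxy).trans ?_
  exact Nat.pow_le_pow_right Fintype.card_pos
    (hr _ (free_blowUp_maximalVertices hT hG hne χ hχ' hom' hhom))

open scoped Classical in
/-- A constant fraction of all colourings of `X` respect a given injective map `φ`. -/
theorem card_colourings_le {V X : Type*} [Fintype V] [Fintype X] {φ : V → X}
    (hφ : Function.Injective φ) :
    Fintype.card (X → Option V) ≤
      (Finset.univ.filter fun χ : X → Option V => ∀ v, χ (φ v) = some v).card *
        Fintype.card (V → Option V) := by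
  rw [← Finset.card_univ (α := V → Option V), ← Finset.card_product, ← Finset.card_univ]
  -- Recolouring the image of `φ` forgets only the old colours there, which the second component
  -- records.
  refine Finset.card_le_card_of_injOn
    (fun ψ => (Function.extend φ some ψ, ψ ∘ φ)) ?_ ?_
  · intro ψ _
    simp [hφ.extend_apply]
  · intro ψ _ ψ' _ h
    rw [Prod.mk.injEq] at h
    funext x
    by_cases hx : ∃ v, φ v = x
    · obtain ⟨v, rfl⟩ := hx
      exact congrFun h.2 v
    · simpa [Function.extend_apply' _ _ _ hx] using congrFun h.1 x

open scoped Classical in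
/-- The number of labelled copies of `H` in a `T`-free graph. -/
theorem labelledCopyCount_le {V W X : Type*} [Fintype V] [Fintype W] [Fintype X] [Nonempty X]
    [Nontrivial W] {H : SimpleGraph V} {T : SimpleGraph W} {G : SimpleGraph X} (hT : T.IsTree)
    (hG : T.Free G) {r : ℕ}
    (hr : ∀ U : Set V, T.Free (blowUp H U) → Nat.card (H.induce U).ConnectedComponent ≤ r) :
    G.labelledCopyCount H ≤ Fintype.card (V → Option V) *
      cleaningConstant (Fintype.card W) (Fintype.card (V × V)) * Fintype.card X ^ r := by
  set B := cleaningConstant (Fintype.card W) (Fintype.card (V × V)) * Fintype.card X ^ r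
  let A : Finset (V → X) := (Finset.univ : Finset (H.Copy G)).image fun f : H.Copy G => (f : V → X)
  have hA : G.labelledCopyCount H = A.card := by
    rw [Finset.card_image_of_injective _ fun f g h => DFunLike.coe_injective h,
      SimpleGraph.labelledCopyCount, Finset.card_univ]
  have hAinj : ∀ φ ∈ A, Function.Injective φ := by
    intro φ hφ
    obtain ⟨f, -, rfl⟩ := Finset.mem_image.1 hφ
    exact f.injective
  have hAhom : ∀ φ ∈ A, ∀ u v, H.Adj u v → G.Adj (φ u) (φ v) := by
    intro φ hφ u v h
    obtain ⟨f, -, rfl⟩ := Finset.mem_image.1 hφ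
    exact f.toHom.map_adj h
  have hpos : 0 < Fintype.card (X → Option V) := Fintype.card_pos
  refine Nat.le_of_mul_le_mul_right (c := Fintype.card (X → Option V)) ?_ hpos
  rw [hA]
  -- Double counting of pairs of a copy and a colouring that it respects.
  calc A.card * Fintype.card (X → Option V)
      ≤ ∑ φ ∈ A, (Finset.univ.filter fun χ : X → Option V => ∀ v, χ (φ v) = some v).card *
        Fintype.card (V → Option V) := by
        rw [← smul_eq_mul]
        exact Finset.card_nsmul_le_sum _ _ _ fun φ hφ => card_colourings_le (hAinj φ hφ)
    _ = (∑ χ : X → Option V, (A.filter fun φ => ∀ v, χ (φ v) = some v).card) *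
        Fintype.card (V → Option V) := by
        rw [← Finset.sum_mul]
        congr 1
        simp only [Finset.card_filter]
        exact Finset.sum_comm
    _ ≤ (Fintype.card (X → Option V) * B) * Fintype.card (V → Option V) := by
        refine Nat.mul_le_mul_right _ ?_
        rw [← smul_eq_mul, ← Finset.card_univ]
        refine Finset.sum_le_card_nsmul _ _ _ fun χ _ => ?_
        refine card_colourRespecting_le hT hG hr χ ?_ ?_
        · intro φ hφ
          exact (Finset.mem_filter.1 hφ).2
        · intro φ hφ
          exact hAhom φ (Finset.mem_filter.1 hφ).1
    _ = Fintype.card (V → Option V) *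
        cleaningConstant (Fintype.card W) (Fintype.card (V × V)) * Fintype.card X ^ r *
          Fintype.card (X → Option V) := by ring

/-! ### Lower bound: copies of `H` in blow-ups -/

theorem free_blowUp_empty {V W : Type*} {H : SimpleGraph V} {T : SimpleGraph W} [Nontrivial W]
    (hT : T.Connected) (hHT : T.Free H) : T.Free (blowUp H ∅) := by
  rintro ⟨g⟩
  have hg : ∀ {w w'}, T.Adj w w' → (blowUp H ∅).Adj (g w) (g w') := fun h => g.toHom.map_adj h
  have h0 : ∀ w, (g w).2 = 0 := by
    intro w
    -- A vertex with a neighbour is not isolated in the blow-up, so its label fits.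
    obtain ⟨w', h⟩ := hT.preconnected.exists_adj_of_nontrivial w
    exact (hg h).2.1.2 (by simp)
  refine hHT ⟨⟨⟨fun w => (g w).1, fun h => (hg h).1⟩, ?_⟩⟩
  intro w w' h
  exact g.injective (Prod.ext h ((h0 w).trans (h0 w').symm))

open scoped Classical in
/-- The copy of `H` in a blow-up which lies in the layer `ℓ c + 1` over the component `c`. -/
noncomputable def layeredVertex {V : Type*} (H : SimpleGraph V) (U : Set V)
    (ℓ : (H.induce U).ConnectedComponent → ℕ) (v : V) : V × ℕ :=
  (v, if h : v ∈ U then ℓ ((H.induce U).connectedComponentMk ⟨v, h⟩) + 1 else 0)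

/-- Adjacent vertices of `U` share a component, hence a layer. -/
theorem layeredVertex_adj {V : Type*} {H : SimpleGraph V} {U : Set V}
    (ℓ : (H.induce U).ConnectedComponent → ℕ) {u v : V} (h : H.Adj u v) :
    (blowUp H U).Adj (layeredVertex H U ℓ u) (layeredVertex H U ℓ v) := by
  refine ⟨h, ?_, ?_, ?_⟩
  · by_cases hu : u ∈ U <;> simp [layeredVertex, hu]
  · by_cases hv : v ∈ U <;> simp [layeredVertex, hv]
  · intro (hu : u ∈ U) (hv : v ∈ U)
    have : (H.induce U).connectedComponentMk ⟨u, hu⟩ =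
        (H.induce U).connectedComponentMk ⟨v, hv⟩ :=
      SimpleGraph.ConnectedComponent.sound (SimpleGraph.Adj.reachable h)
    simp [layeredVertex, hu, hv, this]

/-- A `T`-free blow-up of `H` gives `T`-free graphs with many copies of `H`. -/
theorem pow_le_Ex {V W : Type*} [Fintype V] [Nonempty V] {H : SimpleGraph V}
    {T : SimpleGraph W} {U : Set V} (hU : T.Free (blowUp H U)) {m n : ℕ}
    (hmn : Fintype.card V * (m + 1) ≤ n) :
    m ^ Nat.card (H.induce U).ConnectedComponent ≤ Ex n H T := by
  classical
  have : Fintype (H.induce U).ConnectedComponent := Fintype.ofFinite _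
  have hk : 0 < Fintype.card V := Fintype.card_pos
  have : NeZero (Fintype.card V) := ⟨hk.ne'⟩
  -- This enumerates `V × ℕ` layer by layer, so layers `0` to `m` fit into the first `n` numbers.
  let e : ℕ ≃ V × ℕ := (Nat.divModEquiv (Fintype.card V)).trans
    ((Equiv.prodComm _ _).trans ((Fintype.equivFin V).symm.prodCongr (Equiv.refl ℕ)))
  have he : ∀ v i, i ≤ m → e.symm (v, i) < n := by
    intro v i hi
    have h1 : e.symm (v, i) = i * Fintype.card V + (Fintype.equivFin V v : ℕ) := rfl
    have h2 := (Fintype.equivFin V v).2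
    rw [h1]
    nlinarith
  let G : SimpleGraph (Fin n) := (blowUp H U).comap fun x : Fin n => e x
  have hG : T.Free G := by
    rintro ⟨g⟩
    refine hU ⟨⟨⟨fun w => e (g w), fun h => g.toHom.map_adj h⟩, ?_⟩⟩
    exact e.injective.comp (Fin.val_injective.comp g.injective)
  have hlt : ∀ (ℓ : (H.induce U).ConnectedComponent → Fin m) (v : V),
      e.symm (layeredVertex H U (fun c => ℓ c) v) < n := by
    intro ℓ v
    refine he v _ ?_
    split_ifs with h
    · exact (ℓ _).2
    · exact Nat.zero_le _
  let f : ((H.induce U).ConnectedComponent → Fin m) → H.Copy G := fun ℓ =>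
    ⟨⟨fun v => ⟨_, hlt ℓ v⟩, fun {u v} h => by
      simpa [G] using layeredVertex_adj (fun c => (ℓ c : ℕ)) h⟩, fun u v h => by
      have h' := congrArg (fun x : Fin n => (e x).1) h
      simpa [layeredVertex] using h'⟩
  have hf : Function.Injective fun ℓ => (f ℓ).toSubgraph := by
    intro ℓ ℓ' h
    funext c
    obtain ⟨⟨u, hu⟩, rfl⟩ := c.exists_rep
    -- Copies count as subgraphs, so `ℓ` is read off the vertex set: the copy's only vertex over `u`
    -- shows the layer of the component of `u`.
    have hmem : f ℓ u ∈ (f ℓ').toSubgraph.verts := by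
      have h' : (f ℓ).toSubgraph = (f ℓ').toSubgraph := h
      rw [← h']
      simp [SimpleGraph.Copy.toSubgraph]
    obtain ⟨v, -, hv⟩ : ∃ v, True ∧ f ℓ' v = f ℓ u := by
      simpa [SimpleGraph.Copy.toSubgraph] using hmem
    have hv' : layeredVertex H U (fun c => (ℓ' c : ℕ)) v =
        layeredVertex H U (fun c => (ℓ c : ℕ)) u :=
      e.symm.injective (congrArg Fin.val hv)
    obtain rfl : v = u := congrArg Prod.fst hv'
    have := congrArg Prod.snd hv'
    simp only [layeredVertex, hu, dite_true, Nat.add_right_cancel_iff] at this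
    exact (Fin.ext this).symm
  calc m ^ Nat.card (H.induce U).ConnectedComponent
      = (Finset.univ : Finset ((H.induce U).ConnectedComponent → Fin m)).card := by
        simp [Nat.card_eq_fintype_card]
    _ ≤ G.copyCount H := by
        rw [SimpleGraph.copyCount_eq_card_image_copyToSubgraph]
        exact Finset.card_le_card_of_injOn (fun ℓ => (f ℓ).toSubgraph)
          (fun ℓ _ => Finset.mem_coe.2 (Finset.mem_image_of_mem _ (Finset.mem_univ _)))
          hf.injOn
    _ ≤ Ex n H T :=
        Finset.le_sup (f := fun G : SimpleGraph (Fin n) => G.copyCount H) (by simpa using hG)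

/-! ### The order of magnitude -/

open scoped Classical in
theorem Ex_le {V W : Type*} [Fintype V] [Fintype W] [Nontrivial W] {H : SimpleGraph V}
    {T : SimpleGraph W} (hT : T.IsTree) {r : ℕ}
    (hr : ∀ U : Set V, T.Free (blowUp H U) → Nat.card (H.induce U).ConnectedComponent ≤ r)
    {n : ℕ} (hn : 0 < n) :
    Ex n H T ≤ Fintype.card (V → Option V) *
      cleaningConstant (Fintype.card W) (Fintype.card (V × V)) * n ^ r := by
  have : NeZero n := ⟨hn.ne'⟩
  refine Finset.sup_le fun G hG => ?_
  have hG' : T.Free G := by simpa using hG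
  simpa using SimpleGraph.copyCount_le_labelledCopyCount.trans (labelledCopyCount_le hT hG' hr)

theorem Ex_of_isEmpty {V W : Type*} [IsEmpty V] [Nontrivial W] (H : SimpleGraph V)
    {T : SimpleGraph W} (hT : T.Connected) (n : ℕ) : Ex n H T = 1 := by
  classical
  -- An edge of `T` makes `⊥` a `T`-free graph, so the maximum is over a nonempty set.
  have hbot : T ≠ ⊥ := by
    rintro rfl
    obtain ⟨w⟩ := hT.nonempty
    obtain ⟨w', h⟩ := hT.preconnected.exists_adj_of_nontrivial w
    exact h
  unfold Ex
  simp only [SimpleGraph.copyCount_of_isEmpty]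
  exact Finset.sup_const ⟨⊥, by simpa using SimpleGraph.free_bot hbot⟩ 1

theorem theorem1 {V W : Type*} [Finite V] [Finite W] [Nontrivial W]
    (H : SimpleGraph V) (T : SimpleGraph W) (hT : T.IsTree) (hHT : T.Free H) :
    ∃ r : ℕ, (fun n : ℕ => (Ex n H T : ℝ)) =Θ[Filter.atTop] (fun n : ℕ => (n : ℝ) ^ r) := by
  classical
  cases nonempty_fintype V
  cases nonempty_fintype W
  rcases isEmpty_or_nonempty V with hV | hV
  · exact ⟨0, by simp [Ex_of_isEmpty H hT.connected]⟩
  obtain ⟨U, hU, hmax⟩ := (Set.toFinite {U : Set V | T.Free (blowUp H U)}).exists_maximalFor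
    (fun U => Nat.card (H.induce U).ConnectedComponent) _
    ⟨∅, free_blowUp_empty hT.connected hHT⟩
  have hr : ∀ U' : Set V, T.Free (blowUp H U') → Nat.card (H.induce U').ConnectedComponent ≤
      Nat.card (H.induce U).ConnectedComponent := by
    intro U' hU'
    rcases le_total (Nat.card (H.induce U').ConnectedComponent)
      (Nat.card (H.induce U).ConnectedComponent) with h | h
    · exact h
    · exact hmax hU' h
  set r := Nat.card (H.induce U).ConnectedComponent with hrdef
  set k := Fintype.card V with hk
  have hkpos : 0 < k := Fintype.card_pos
  refine ⟨r, ?_, ?_⟩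
  · refine Asymptotics.IsBigO.of_bound ((Fintype.card (V → Option V) *
      cleaningConstant (Fintype.card W) (Fintype.card (V × V)) : ℕ) : ℝ) ?_
    filter_upwards [Filter.eventually_gt_atTop 0] with n hn
    have := Ex_le hT hr hn
    rw [Real.norm_of_nonneg (by positivity), Real.norm_of_nonneg (by positivity)]
    exact_mod_cast this
  · refine Asymptotics.IsBigO.of_bound ((4 * k : ℝ) ^ r) ?_
    filter_upwards [Filter.eventually_ge_atTop (2 * k)] with n hn
    -- Since `m ≥ 1`, `k(m + 1) ≤ 2km ≤ n`, so the layers fit, and `n < 2k(m + 1) ≤ 4km`.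
    set m := n / (2 * k) with hm
    have hm1 : 1 ≤ m := (Nat.one_le_div_iff (by omega)).2 hn
    have hle : 2 * k * m ≤ n := Nat.mul_div_le n (2 * k)
    have hlt : n < 2 * k * (m + 1) := Nat.lt_mul_div_succ n (by omega)
    have hEx : m ^ r ≤ Ex n H T := pow_le_Ex hU (by nlinarith)
    have hn4 : n ≤ 4 * k * m := by nlinarith
    rw [Real.norm_of_nonneg (by positivity), Real.norm_of_nonneg (by positivity)]
    calc (n : ℝ) ^ r ≤ (4 * k * m : ℝ) ^ r := by
          gcongr
          exact_mod_cast hn4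
      _ = (4 * k : ℝ) ^ r * (m : ℝ) ^ r := mul_pow _ _ _
      _ ≤ (4 * k : ℝ) ^ r * Ex n H T := by
          gcongr
          exact_mod_cast hEx
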